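/- Let $\mathcal{H}$ be the real vector space of bounded measurable symmetric functions $h:[0,1]^2\to\mathbb{R}$, where functions that agree almost everywhere are identified. For a finite simple graph $G$ with vertex set $V$, edge set $E(G)\neq\emptyset$, and $h\in\mathcal{H}$, let $$t_G(h)=\int_{[0,1]^V}\ \prod_{\{u,v\}\in E(G)}h(x_u,x_v)\,\prod_{v\in V}dx_v .$$ Call $G$ weakly norming if $h\mapsto t_G(|h|)^{1/|E(G)|}$ is a norm on $\mathcal{H}$. Then every weakly norming graph $G$ is edge-transitive: for any two edges $e,f\in E(G)$ there is an automorphism of $G$ that maps $e$ to $f$. -/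

import Mathlib

open MeasureTheory
open scoped unitInterval

namespace GraphNorm

/-- The real vector space of bounded measurable symmetric functions on `[0,1]²`. -/
def kernels : Submodule ℝ (I → I → ℝ) where
  carrier := {h | Measurable (Function.uncurry h) ∧ (∃ C : ℝ, ∀ x y, |h x y| ≤ C) ∧
    ∀ x y, h x y = h y x}
  zero_mem' := ⟨measurable_const, ⟨0, fun x y => by simp⟩, fun _ _ => rfl⟩
  add_mem' := by
    rintro f g ⟨hf, ⟨C, hC⟩, hfs⟩ ⟨hg, ⟨D, hD⟩, hgs⟩
    exact ⟨hf.add hg,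
      ⟨C + D, fun x y => (abs_add_le (f x y) (g x y)).trans (add_le_add (hC x y) (hD x y))⟩,
      fun x y => congrArg₂ (· + ·) (hfs x y) (hgs x y)⟩
  smul_mem' := by
    rintro c f ⟨hf, ⟨C, hC⟩, hfs⟩
    exact ⟨hf.const_mul c,
      ⟨|c| * C, fun x y => (abs_mul c (f x y)).le.trans
        (mul_le_mul_of_nonneg_left (hC x y) (abs_nonneg c))⟩,
      fun x y => congrArg (c * ·) (hfs x y)⟩

/-- The pointwise absolute value `|h|` of a kernel `h`. -/
def absKernel (h : kernels) : kernels :=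
  ⟨fun x y => |h.1 x y|,
    ⟨continuous_abs.measurable.comp h.2.1,
      h.2.2.1.imp fun _ hC x y => (abs_abs (h.1 x y)).le.trans (hC x y),
      fun x y => congrArg abs (h.2.2.2 x y)⟩⟩

/-- The factor `h(x_u, x_v)` that an unordered pair `{u, v}` of vertices contributes at the point
`x ∈ [0,1]^V`; it is well defined since `h` is symmetric. -/
def pairValue {V : Type*} (h : kernels) (x : V → I) (e : Sym2 V) : ℝ :=
  Sym2.lift ⟨fun u v => h.1 (x u) (x v), fun u v => h.2.2.2 (x u) (x v)⟩ e

/-- The homomorphism density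
`t_G(h) = ∫ ∏_{uv ∈ E(G)} h(x_u, x_v) dx`, where `x` ranges over `[0,1]^V`. -/
noncomputable def homDensity {V : Type*} [Fintype V] (G : SimpleGraph V) [Fintype G.edgeSet]
    (h : kernels) : ℝ :=
  ∫ x : V → I, ∏ e ∈ G.edgeFinset, pairValue h x e

/-- The functional `h ↦ t_G(|h|)^{1/|E(G)|}`. -/
noncomputable def weakNorm {V : Type*} [Fintype V] (G : SimpleGraph V) [Fintype G.edgeSet]
    (h : kernels) : ℝ :=
  homDensity G (absKernel h) ^ (1 / (G.edgeFinset.card : ℝ))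

/-- `N` is a norm on the space of kernels, where, as usual, kernels that agree almost everywhere
are identified. -/
structure IsKernelNorm (N : kernels → ℝ) : Prop where
  nonneg : ∀ h, 0 ≤ N h
  add_le : ∀ g h, N (g + h) ≤ N g + N h
  smul : ∀ (c : ℝ) (h : kernels), N (c • h) = |c| * N h
  eq_zero_iff : ∀ h : kernels, N h = 0 ↔ ∀ᵐ p : I × I, h.1 p.1 p.2 = 0

/-- `G` is weakly norming if `t_G(|h|)^{1/|E(G)|}` is a norm. -/
def WeaklyNorming {V : Type*} [Fintype V] (G : SimpleGraph V) [Fintype G.edgeSet] : Prop :=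
  IsKernelNorm (weakNorm G)

/-- `G` is edge-transitive if its automorphism group acts transitively on its edges. -/
def EdgeTransitive {V : Type*} (G : SimpleGraph V) : Prop :=
  ∀ e ∈ G.edgeSet, ∀ f ∈ G.edgeSet, ∃ φ : G ≃g G, Sym2.map φ e = f

end GraphNorm

namespace GraphNorm

/-- The sum over all maps `x : V → S` of the product of the weights `A` of the images of the
pairs in `E`. -/
def homSum {V S : Type*} [Fintype V] [DecidableEq V] [Fintype S]
    (E : Finset (Sym2 V)) (A : Sym2 S → ℝ) : ℝ :=
  ∑ x : V → S, ∏ e ∈ E, A (e.map x)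

/-- The variant of `homSum` in which the pair `e` is weighted by `B` instead of `A`. -/
def markedSum {V S : Type*} [Fintype V] [DecidableEq V] [Fintype S]
    (E : Finset (Sym2 V)) (e : Sym2 V) (A B : Sym2 S → ℝ) : ℝ :=
  ∑ x : V → S, (∏ e' ∈ E.erase e, A (e'.map x)) * B (e.map x)

/-- The tensor power of a symmetric weight. -/
def tensorPower {S : Type*} (k : ℕ) (A : Sym2 S → ℝ) : Sym2 (Fin k → S) → ℝ :=
  fun z => ∏ i, A (z.map (fun p => p i))

/-- Triangle inequality for `homSum E A ^ (1 / |E|)` on nonnegative weights. -/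
def HomSumTriangle {V : Type*} [Fintype V] [DecidableEq V] (E : Finset (Sym2 V))
    (S : Type*) [Fintype S] : Prop :=
  ∀ A B : Sym2 S → ℝ, (∀ z, 0 ≤ A z) → (∀ z, 0 ≤ B z) →
    homSum E (fun z => A z + B z) ^ (1 / (E.card : ℝ)) ≤
      homSum E A ^ (1 / (E.card : ℝ)) + homSum E B ^ (1 / (E.card : ℝ))

lemma deriv_le_of_le_right {p q : ℝ → ℝ} {p' q' : ℝ} (hp : HasDerivAt p p' 0)
    (hq : HasDerivAt q q' 0) (h0 : p 0 = q 0) (h : ∀ s, 0 < s → p s ≤ q s) : p' ≤ q' := by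
  have hd : HasDerivWithinAt (fun s => q s - p s) (q' - p') (Set.Ioi 0) 0 :=
    (hq.sub hp).hasDerivWithinAt
  rw [hasDerivWithinAt_iff_tendsto_slope' (by simp)] at hd
  have : 0 ≤ q' - p' := by
    refine ge_of_tendsto hd ?_
    filter_upwards [self_mem_nhdsWithin] with s hs
    have hs' : (0 : ℝ) < s := hs
    simp only [slope_def_field, h0, sub_self, sub_zero]
    exact div_nonneg (sub_nonneg.2 (h s hs')) hs'.le
  linarith

lemma le_of_pow_le_mul_pow {x y m : ℝ} (hy : 0 ≤ y)
    (h : ∀ k : ℕ, x ^ k ≤ m * y ^ k) : x ≤ y := by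
  by_contra! hlt
  rcases hy.eq_or_lt with rfl | hy
  · have := h 1
    simp at this
    linarith
  · obtain ⟨k, hk⟩ := pow_unbounded_of_one_lt m ((one_lt_div hy).2 hlt)
    rw [div_pow, lt_div_iff₀ (by positivity)] at hk
    exact (h k).not_gt hk

lemma prod_tensorPower {V S : Type*} (F : Finset (Sym2 V)) (k : ℕ) (A : Sym2 S → ℝ) (x : V → Fin k → S) :
    ∏ e ∈ F, tensorPower k A (e.map x) = ∏ i, ∏ e ∈ F, A (e.map fun v => x v i) := by
  simp only [tensorPower, Sym2.map_map]
  rw [Finset.prod_comm]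
  rfl

lemma tensorPower_nonneg {S : Type*} (k : ℕ) {A : Sym2 S → ℝ} (hA : ∀ z, 0 ≤ A z) (z : Sym2 (Fin k → S)) :
    0 ≤ tensorPower k A z :=
  Finset.prod_nonneg fun _ _ => hA _

section HomSum

variable {V : Type*} [Fintype V] [DecidableEq V] {S : Type*} [Fintype S]

lemma homSum_nonneg (E : Finset (Sym2 V)) {A : Sym2 S → ℝ} (hA : ∀ z, 0 ≤ A z) :
    0 ≤ homSum E A :=
  Finset.sum_nonneg fun _ _ => Finset.prod_nonneg fun _ _ => hA _

lemma markedSum_nonneg (E : Finset (Sym2 V)) (e : Sym2 V) {A B : Sym2 S → ℝ}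
    (hA : ∀ z, 0 ≤ A z) (hB : ∀ z, 0 ≤ B z) : 0 ≤ markedSum E e A B :=
  Finset.sum_nonneg fun _ _ => mul_nonneg (Finset.prod_nonneg fun _ _ => hA _) (hB _)

lemma homSum_const_mul (E : Finset (Sym2 V)) (s : ℝ) (A : Sym2 S → ℝ) :
    homSum E (fun z => s * A z) = s ^ E.card * homSum E A := by
  simp [homSum, Finset.prod_mul_distrib, Finset.mul_sum]

lemma markedSum_self {E : Finset (Sym2 V)} {e : Sym2 V} (he : e ∈ E) (A : Sym2 S → ℝ) :
    markedSum E e A A = homSum E A := by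
  simp only [markedSum, homSum]
  exact Finset.sum_congr rfl fun x _ => Finset.prod_erase_mul _ _ he

lemma markedSum_add_const_mul (E : Finset (Sym2 V)) (e : Sym2 V) (A B C : Sym2 S → ℝ) (s : ℝ) :
    markedSum E e A (fun z => B z + s * C z) = markedSum E e A B + s * markedSum E e A C := by
  simp only [markedSum, Finset.mul_sum, ← Finset.sum_add_distrib]
  exact Finset.sum_congr rfl fun x _ => by ring

lemma hasDerivAt_homSum (E : Finset (Sym2 V)) (A B : Sym2 S → ℝ) :
    HasDerivAt (fun s : ℝ => homSum E (fun z => A z + s * B z))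
      (∑ e ∈ E, markedSum E e A B) 0 := by
  simp only [homSum, markedSum]
  rw [Finset.sum_comm]
  refine HasDerivAt.fun_sum fun x _ => ?_
  have h := HasDerivAt.fun_finsetProd (𝕜 := ℝ) (x := (0 : ℝ)) (u := E)
    (f := fun e s => A (e.map x) + s * B (e.map x)) (f' := fun e => B (e.map x))
    (fun e _ => by
      simpa using ((hasDerivAt_id (0 : ℝ)).mul_const (B (e.map x))).const_add (A (e.map x)))
  simpa using h

lemma sum_pow_eq_sum_prod (f : (V → S) → ℝ) (k : ℕ) :
    (∑ x, f x) ^ k = ∑ x : V → Fin k → S, ∏ i, f fun v => x v i := by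
  rw [Fintype.sum_pow]
  exact Fintype.sum_equiv (Equiv.piComm fun _ _ => S) _ _ fun p => rfl

lemma homSum_tensorPower (E : Finset (Sym2 V)) (k : ℕ) (A : Sym2 S → ℝ) :
    homSum E (tensorPower k A) = homSum E A ^ k := by
  simp only [homSum, sum_pow_eq_sum_prod, prod_tensorPower]

lemma markedSum_tensorPower (E : Finset (Sym2 V)) (e : Sym2 V) (k : ℕ) (A B : Sym2 S → ℝ) :
    markedSum E e (tensorPower k A) (tensorPower k B) = markedSum E e A B ^ k := by
  simp only [markedSum, sum_pow_eq_sum_prod, prod_tensorPower, Finset.prod_mul_distrib]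
  refine Finset.sum_congr rfl fun x _ => ?_
  congr 1
  simpa using prod_tensorPower {e} k B x

lemma HomSumTriangle.sum_markedSum_le {E : Finset (Sym2 V)} (h : HomSumTriangle E S)
    (hE : E.Nonempty) {A B : Sym2 S → ℝ} (hA : ∀ z, 0 ≤ A z) (hB : ∀ z, 0 ≤ B z) :
    ∑ e ∈ E, markedSum E e A B ≤ E.card * ((homSum E A ^ (1 / (E.card : ℝ))) ^ (E.card - 1) *
      homSum E B ^ (1 / (E.card : ℝ))) := by
  have hm : E.card ≠ 0 := hE.card_ne_zero
  set a := homSum E A ^ (1 / (E.card : ℝ)) with ha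
  set b := homSum E B ^ (1 / (E.card : ℝ)) with hb
  have hroot : ∀ {C : Sym2 S → ℝ}, (∀ z, 0 ≤ C z) →
      (homSum E C ^ (1 / (E.card : ℝ))) ^ E.card = homSum E C := fun hC => by
    rw [one_div, Real.rpow_inv_natCast_pow (homSum_nonneg E hC) hm]
  have hq : HasDerivAt (fun s : ℝ => (a + s * b) ^ E.card)
      (E.card * (a ^ (E.card - 1) * b)) 0 := by
    have := (((hasDerivAt_id (0 : ℝ)).mul_const b).const_add a).fun_pow E.card
    simpa [mul_assoc] using this
  refine deriv_le_of_le_right (hasDerivAt_homSum E A B) hq ?_ fun s hs => ?_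
  · simp only [zero_mul, add_zero]
    exact (hroot hA).symm
  · have hsB : ∀ z, 0 ≤ s * B z := fun z => mul_nonneg hs.le (hB z)
    have h1 := h A (fun z => s * B z) hA hsB
    have h2 : homSum E (fun z => s * B z) ^ (1 / (E.card : ℝ)) = s * b := by
      rw [homSum_const_mul, Real.mul_rpow (by positivity) (homSum_nonneg E hB), one_div,
        Real.pow_rpow_inv_natCast hs.le hm, hb, one_div]
    rw [h2] at h1
    have hAB : ∀ z, 0 ≤ A z + s * B z := fun z => add_nonneg (hA z) (hsB z)
    have h3 := pow_le_pow_left₀ (Real.rpow_nonneg (homSum_nonneg E hAB) _) h1 E.card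
    rwa [hroot hAB] at h3

lemma markedSum_le {E : Finset (Sym2 V)} (h : ∀ k : ℕ, HomSumTriangle E (Fin k → S))
    {e : Sym2 V} (he : e ∈ E) {A B : Sym2 S → ℝ} (hA : ∀ z, 0 ≤ A z) (hB : ∀ z, 0 ≤ B z) :
    markedSum E e A B ≤ (homSum E A ^ (1 / (E.card : ℝ))) ^ (E.card - 1) *
      homSum E B ^ (1 / (E.card : ℝ)) := by
  have hA0 := homSum_nonneg E hA
  have hB0 := homSum_nonneg E hB
  refine le_of_pow_le_mul_pow (m := E.card) (by positivity)
    fun k => ?_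
  have h1 := (h k).sum_markedSum_le ⟨e, he⟩ (tensorPower_nonneg k hA) (tensorPower_nonneg k hB)
  simp only [homSum_tensorPower, markedSum_tensorPower] at h1
  have hcomm : ∀ {t : ℝ}, 0 ≤ t → (t ^ k) ^ (1 / (E.card : ℝ)) = (t ^ (1 / (E.card : ℝ))) ^ k :=
    fun ht => (Real.rpow_pow_comm ht _ _).symm
  rw [hcomm hA0, hcomm hB0, ← pow_mul, mul_comm k, pow_mul, ← mul_pow] at h1
  exact (Finset.single_le_sum (f := fun e => markedSum E e A B ^ k)
    (fun e' _ => pow_nonneg (markedSum_nonneg E e' hA hB) k) he).trans h1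

lemma card_mul_markedSum_le {E : Finset (Sym2 V)} (h : ∀ k : ℕ, HomSumTriangle E (Fin k → S))
    (hE : 1 < E.card) {e : Sym2 V} (he : e ∈ E) {A B : Sym2 S → ℝ} (hA : ∀ z, 0 ≤ A z)
    (hB : ∀ z, 0 ≤ B z) : E.card * markedSum E e A B ≤ ∑ e' ∈ E, markedSum E e' A B := by
  have hm : E.card ≠ 0 := by omega
  have hroot : ∀ {C : Sym2 S → ℝ}, (∀ z, 0 ≤ C z) →
      (homSum E C ^ (1 / (E.card : ℝ))) ^ E.card = homSum E C := fun hC => by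
    rw [one_div, Real.rpow_inv_natCast_pow (homSum_nonneg E hC) hm]
  rcases (homSum_nonneg E hA).eq_or_lt with h0 | hpos
  · have h1 := markedSum_le h he hA hB
    rw [← h0, Real.zero_rpow (by positivity), zero_pow (by omega), zero_mul] at h1
    rw [h1.antisymm (markedSum_nonneg E e hA hB), mul_zero]
    exact Finset.sum_nonneg fun e' _ => markedSum_nonneg E e' hA hB
  · set T := homSum E A with hT
    have hp : HasDerivAt (fun s : ℝ => (T + s * markedSum E e A B) ^ E.card)
        (E.card * (T ^ (E.card - 1) * markedSum E e A B)) 0 := by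
      have := (((hasDerivAt_id (0 : ℝ)).mul_const (markedSum E e A B)).const_add T).fun_pow E.card
      simpa [mul_assoc] using this
    have hq := (hasDerivAt_homSum E A B).const_mul (T ^ (E.card - 1))
    have key := deriv_le_of_le_right hp hq (by
      simp only [zero_mul, add_zero]
      exact (pow_sub_one_mul hm _).symm) fun s hs => by
      have hAB : ∀ z, 0 ≤ A z + s * B z := fun z => add_nonneg (hA z) (mul_nonneg hs.le (hB z))
      have h1 := markedSum_le h he hA hAB
      rw [markedSum_add_const_mul, markedSum_self he] at h1
      have h2 := pow_le_pow_left₀ (add_nonneg hpos.le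
        (mul_nonneg hs.le (markedSum_nonneg E e hA hB))) h1 E.card
      rwa [mul_pow, hroot hAB, ← pow_mul, mul_comm (E.card - 1), pow_mul, hroot hA] at h2
    have hTp : 0 < T ^ (E.card - 1) := by positivity
    rw [mul_left_comm] at key
    exact le_of_mul_le_mul_left key hTp

lemma markedSum_eq_markedSum {E : Finset (Sym2 V)}
    (h : ∀ k : ℕ, HomSumTriangle E (Fin k → S)) {e f : Sym2 V} (he : e ∈ E) (hf : f ∈ E)
    {A B : Sym2 S → ℝ} (hA : ∀ z, 0 ≤ A z) (hB : ∀ z, 0 ≤ B z) :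
    markedSum E e A B = markedSum E f A B := by
  by_cases hE : 1 < E.card
  · have hall : ∀ e ∈ E, E.card * markedSum E e A B = ∑ e' ∈ E, markedSum E e' A B := by
      have hsum : ∑ e ∈ E, E.card * markedSum E e A B =
          ∑ _e ∈ E, ∑ e' ∈ E, markedSum E e' A B := by
        rw [← Finset.mul_sum, Finset.sum_const, nsmul_eq_mul]
      exact (Finset.sum_eq_sum_iff_of_le
        fun e he => card_mul_markedSum_le h hE he hA hB).1 hsum
    have hm : (E.card : ℝ) ≠ 0 := by
      norm_cast
      omega
    exact mul_left_cancel₀ hm ((hall e he).trans (hall f hf).symm)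
  · rw [Finset.card_le_one.1 (not_lt.1 hE) e he f hf]

end HomSum

section Automorphism

variable {V : Type*} [Fintype V] [DecidableEq V]

/-- The vertices that are covered by `E`. -/
def coveredVertices (E : Finset (Sym2 V)) : Finset V :=
  Finset.univ.filter fun v => ∃ d ∈ E, v ∈ d

lemma mem_coveredVertices {E : Finset (Sym2 V)} {v : V} :
    v ∈ coveredVertices E ↔ ∃ d ∈ E, v ∈ d := by
  simp [coveredVertices]

/-- The maps `V → V` that send all pairs in `E` to pairs in `E` and `e` to `f`. -/
def markedEndos (E : Finset (Sym2 V)) (f e : Sym2 V) : Finset (V → V) :=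
  Finset.univ.filter fun x => (∀ d ∈ E, d.map x ∈ E) ∧ e.map x = f

lemma mem_markedEndos {E : Finset (Sym2 V)} {f e : Sym2 V} {x : V → V} :
    x ∈ markedEndos E f e ↔ (∀ d ∈ E, d.map x ∈ E) ∧ e.map x = f := by
  simp [markedEndos]

lemma card_filter_image_subset {E : Finset (Sym2 V)} {e f : Sym2 V} (he : e ∈ E) (hf : f ∈ E)
    (U : Finset V) :
    (((markedEndos E f e).filter fun x => (coveredVertices E).image x ⊆ U).card : ℝ) =
      markedSum E e (fun z => if z ∈ E ∧ ∀ v ∈ z, v ∈ U then 1 else 0)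
        (fun z => if z = f ∧ ∀ v ∈ z, v ∈ U then 1 else 0) := by
  simp only [markedSum, Finset.prod_boole, ← ite_and, mul_ite, mul_one, mul_zero]
  rw [markedEndos, Finset.filter_filter, Finset.natCast_card_filter]
  refine Finset.sum_congr rfl fun x _ => ?_
  suffices hiff : ((∀ d ∈ E, d.map x ∈ E) ∧ e.map x = f) ∧
      (coveredVertices E).image x ⊆ U ↔ (e.map x = f ∧ ∀ v ∈ e.map x, v ∈ U) ∧
        ∀ d ∈ E.erase e, d.map x ∈ E ∧ ∀ v ∈ d.map x, v ∈ U by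
    split_ifs with h1 h2 h2
    exacts [rfl, absurd (hiff.1 h1) h2, absurd (hiff.2 h2) h1, rfl]
  have hcov : (coveredVertices E).image x ⊆ U ↔ ∀ d ∈ E, ∀ v ∈ d, x v ∈ U := by
    simp only [Finset.image_subset_iff, mem_coveredVertices]
    exact ⟨fun h d hd v hv => h v ⟨d, hd, hv⟩, fun h v ⟨d, hd, hv⟩ => h d hd v hv⟩
  simp only [hcov, Finset.mem_erase, Sym2.mem_map, forall_exists_index, and_imp, forall_apply_eq_imp_iff₂]
  constructor
  · rintro ⟨⟨h1, h2⟩, h3⟩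
    exact ⟨⟨h2, h3 e he⟩, fun d _ hd => ⟨h1 d hd, h3 d hd⟩⟩
  · rintro ⟨⟨h1, h2⟩, h3⟩
    have h4 : ∀ d ∈ E, d.map x ∈ E ∧ ∀ v ∈ d, x v ∈ U := fun d hd => by
      by_cases hde : d = e
      · subst hde
        exact ⟨h1 ▸ hf, h2⟩
      · exact h3 d hde hd
    exact ⟨⟨fun d hd => (h4 d hd).1, h1⟩, fun d hd => (h4 d hd).2⟩

lemma card_filter_image_eq {E : Finset (Sym2 V)} {e e' f : Sym2 V}
    (h : ∀ U : Finset V,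
      ((markedEndos E f e).filter fun x => (coveredVertices E).image x ⊆ U).card =
        ((markedEndos E f e').filter fun x => (coveredVertices E).image x ⊆ U).card)
    (U : Finset V) :
    ((markedEndos E f e).filter fun x => (coveredVertices E).image x = U).card =
      ((markedEndos E f e').filter fun x => (coveredVertices E).image x = U).card := by
  induction U using Finset.strongInduction with
  | H U ih =>
    have hfib : ∀ d : Sym2 V,
        ((markedEndos E f d).filter fun x => (coveredVertices E).image x ⊆ U).card =
          ((markedEndos E f d).filter fun x => (coveredVertices E).image x = U).card +
          ∑ U' ∈ U.ssubsets,
            ((markedEndos E f d).filter fun x => (coveredVertices E).image x = U').card := by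
      intro d
      rw [← Finset.sum_insert (f := fun U' =>
        ((markedEndos E f d).filter fun x => (coveredVertices E).image x = U').card)
        (by simp [Finset.mem_ssubsets]), Finset.ssubsets, Finset.insert_erase
        (Finset.mem_powerset_self U), Finset.card_eq_sum_card_fiberwise
        (f := fun x => (coveredVertices E).image x) (t := U.powerset)
        (fun x hx => Finset.mem_coe.2 (Finset.mem_powerset.2 (Finset.mem_filter.1 hx).2))]
      refine Finset.sum_congr rfl fun U' hU' => ?_
      rw [Finset.filter_filter]
      congr 1
      refine Finset.filter_congr fun x _ => ?_
      exact ⟨fun hx => hx.2, fun hx => ⟨hx.subset.trans (Finset.mem_powerset.1 hU'), hx⟩⟩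
    have h1 := h U
    rw [hfib, hfib, Finset.sum_congr rfl fun U' hU' => ih U' (Finset.mem_ssubsets.1 hU')] at h1
    exact Nat.add_right_cancel h1

lemma exists_iso_of_image_covered_eq {G : SimpleGraph V} [Fintype G.edgeSet] {e f : Sym2 V}
    (he : e ∈ G.edgeFinset) {x : V → V} (hx : x ∈ markedEndos G.edgeFinset f e)
    (hW : (coveredVertices G.edgeFinset).image x = coveredVertices G.edgeFinset) :
    ∃ φ : G ≃g G, Sym2.map φ e = f := by
  set W := coveredVertices G.edgeFinset with hWdef
  obtain ⟨hx1, hx2⟩ := mem_markedEndos.1 hx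
  have hinj : Set.InjOn x W := Finset.injOn_of_card_image_eq (by rw [hW])
  have hmaps : ∀ v ∈ W, x v ∈ W := fun v hv => hW ▸ Finset.mem_image_of_mem x hv
  let y : V → V := fun v => if v ∈ W then x v else v
  have hyx : ∀ v ∈ W, y v = x v := fun v hv => if_pos hv
  have hy : Function.Injective y := by
    intro u v huv
    by_cases hu : u ∈ W <;> by_cases hv : v ∈ W <;> simp only [y, hu, hv, if_true, if_false] at huv
    · exact hinj hu hv huv
    · exact absurd (huv ▸ hmaps u hu) hv
    · exact absurd (huv ▸ hmaps v hv) hu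
    · exact huv
  have hmap : ∀ d ∈ G.edgeFinset, d.map y = d.map x := fun d hd =>
    Sym2.map_congr fun v hv => hyx v (mem_coveredVertices.2 ⟨d, hd, hv⟩)
  have himage : G.edgeFinset.image (Sym2.map y) = G.edgeFinset := by
    refine Finset.eq_of_subset_of_card_le (fun d hd => ?_) ?_
    · obtain ⟨c, hc, rfl⟩ := Finset.mem_image.1 hd
      exact hmap c hc ▸ hx1 c hc
    · rw [Finset.card_image_of_injective _ (Sym2.map.injective hy)]
  have hmem : ∀ d, d.map y ∈ G.edgeFinset ↔ d ∈ G.edgeFinset := fun d => by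
    conv_lhs => rw [← himage]
    exact (Sym2.map.injective hy).mem_finset_image
  refine ⟨⟨Equiv.ofBijective y (Finite.injective_iff_bijective.1 hy), fun {u v} => ?_⟩, ?_⟩
  · simpa using hmem s(u, v)
  · exact (hmap e he).trans hx2

lemma edgeTransitive_of_homSumTriangle {G : SimpleGraph V} [Fintype G.edgeSet]
    (h : ∀ k : ℕ, HomSumTriangle G.edgeFinset (Fin k → V)) : EdgeTransitive G := by
  intro e he f hf
  rw [← SimpleGraph.mem_edgeFinset] at he hf
  have hsub : ∀ U : Finset V,
      ((markedEndos G.edgeFinset f e).filter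
        fun x => (coveredVertices G.edgeFinset).image x ⊆ U).card =
      ((markedEndos G.edgeFinset f f).filter
        fun x => (coveredVertices G.edgeFinset).image x ⊆ U).card := fun U => by
    have h1 := markedSum_eq_markedSum h he hf
      (A := fun z => if z ∈ G.edgeFinset ∧ ∀ v ∈ z, v ∈ U then 1 else 0)
      (B := fun z => if z = f ∧ ∀ v ∈ z, v ∈ U then 1 else 0)
      (fun z => by split_ifs <;> simp) (fun z => by split_ifs <;> simp)
    rw [← card_filter_image_subset he hf, ← card_filter_image_subset hf hf] at h1
    exact_mod_cast h1
  have heq := card_filter_image_eq hsub (coveredVertices G.edgeFinset)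
  have hid : id ∈ (markedEndos G.edgeFinset f f).filter
      fun x => (coveredVertices G.edgeFinset).image x = coveredVertices G.edgeFinset := by
    simp [mem_markedEndos]
  obtain ⟨x, hx⟩ := Finset.card_pos.1 (heq ▸ Finset.card_pos.2 ⟨id, hid⟩)
  obtain ⟨hx1, hx2⟩ := Finset.mem_filter.1 hx
  exact exists_iso_of_image_covered_eq he hx1 hx2

end Automorphism

section StepKernel

/-- The unit interval can be cut into `n` measurable pieces of equal measure. -/
lemma exists_measurable_equipartition (n : ℕ) [NeZero n] :
    ∃ q : I → Fin n, Measurable q ∧ ∀ i, (volume : Measure I).real (q ⁻¹' {i}) = (n : ℝ)⁻¹ := by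
  have hn : (0 : ℝ) < n := by exact_mod_cast NeZero.pos n
  let q : I → Fin n := fun x => Fin.ofNat n ⌊(n : ℝ) * x⌋₊
  refine ⟨q, (measurable_from_top (f := fun k : ℕ => Fin.ofNat n k)).comp
    (Nat.measurable_floor.comp (measurable_subtype_coe.const_mul _)), fun i => ?_⟩
  have hi : (i : ℝ) + 1 ≤ n := by exact_mod_cast i.2
  let a : I := ⟨i / n, by positivity, by rw [div_le_one hn]; linarith⟩
  let b : I := ⟨(i + 1) / n, by positivity, by rwa [div_le_one hn]⟩
  have hab : volume (Set.Ico a b) = ENNReal.ofReal (n : ℝ)⁻¹ := by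
    rw [unitInterval.volume_Ico]
    congr 1
    simp only [a, b]
    ring
  have hsub : Set.Ico a b ⊆ q ⁻¹' {i} := by
    rintro x ⟨h1, h2⟩
    have h1' : (i : ℝ) / n ≤ x := h1
    have h2' : (x : ℝ) < (i + 1) / n := h2
    rw [div_le_iff₀' hn] at h1'
    rw [lt_div_iff₀' hn] at h2'
    have hfl : ⌊(n : ℝ) * x⌋₊ = i := (Nat.floor_eq_iff (by have := x.2.1; positivity)).2 ⟨h1', h2'⟩
    simp [q, hfl]
  have hsup : q ⁻¹' {i} ⊆ Set.Ico a b ∪ {1} := by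
    intro x hx
    by_cases hx1 : x = 1
    · exact Or.inr hx1
    have hxlt : (x : ℝ) < 1 := lt_of_le_of_ne x.2.2 fun h => hx1 (Subtype.ext h)
    have hx0 : 0 ≤ (n : ℝ) * x := by have := x.2.1; positivity
    have hfl : ⌊(n : ℝ) * x⌋₊ < n := (Nat.floor_lt hx0).2 (by nlinarith)
    have hxi : ⌊(n : ℝ) * x⌋₊ = i := by
      have : q x = i := hx
      simpa [q, Nat.mod_eq_of_lt hfl] using congrArg Fin.val this
    obtain ⟨h1, h2⟩ := (Nat.floor_eq_iff hx0).1 hxi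
    refine Or.inl ⟨?_, ?_⟩
    · change (i : ℝ) / n ≤ x
      rwa [div_le_iff₀' hn]
    · change (x : ℝ) < (i + 1) / n
      rwa [lt_div_iff₀' hn]
  have hvol : volume (q ⁻¹' {i}) = ENNReal.ofReal (n : ℝ)⁻¹ := by
    refine le_antisymm ((measure_mono hsup).trans ((measure_union_le _ _).trans ?_))
      (hab ▸ measure_mono hsub)
    simp [hab]
  rw [Measure.real, hvol, ENNReal.toReal_ofReal (by positivity)]

variable {S : Type*} [Fintype S] [MeasurableSpace S] [DiscreteMeasurableSpace S]

/-- The step kernel with weights `A` on the pieces of the partition `q`. -/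
def stepKernel {q : I → S} (hq : Measurable q) (A : Sym2 S → ℝ) : kernels :=
  ⟨fun x y => A s(q x, q y),
    (Measurable.of_discrete (f := fun p : S × S => A s(p.1, p.2))).comp
      ((hq.comp measurable_fst).prodMk (hq.comp measurable_snd)),
    ⟨∑ z, |A z|, fun x y => Finset.single_le_sum (f := fun z => |A z|)
      (fun _ _ => abs_nonneg _) (Finset.mem_univ s(q x, q y))⟩,
    fun _ _ => congrArg A Sym2.eq_swap⟩

lemma absKernel_stepKernel {q : I → S} (hq : Measurable q) {A : Sym2 S → ℝ}
    (hA : ∀ z, 0 ≤ A z) : absKernel (stepKernel hq A) = stepKernel hq A :=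
  Subtype.ext <| funext fun x => funext fun y => abs_of_nonneg (hA s(q x, q y))

lemma pairValue_stepKernel {V : Type*} {q : I → S} (hq : Measurable q) (A : Sym2 S → ℝ)
    (x : V → I) (e : Sym2 V) :
    pairValue (stepKernel hq A) x e = A (e.map fun v => q (x v)) := by
  induction e with
  | _ u v => rfl

lemma homDensity_stepKernel {V : Type*} [Fintype V] [DecidableEq V] (G : SimpleGraph V)
    [Fintype G.edgeSet] {q : I → S} (hq : Measurable q)
    {c : ℝ} (hc : ∀ i, (volume : Measure I).real (q ⁻¹' {i}) = c) (A : Sym2 S → ℝ) :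
    homDensity G (stepKernel hq A) = c ^ Fintype.card V * homSum G.edgeFinset A := by
  have hmap : (volume : Measure (V → I)).map (fun x v => q (x v)) =
      Measure.pi fun _ : V => (volume : Measure I).map q :=
    Measure.pi_map_pi fun _ => hq.aemeasurable
  have hprob : IsProbabilityMeasure ((volume : Measure I).map q) :=
    Measure.isProbabilityMeasure_map hq.aemeasurable
  have hmeas : Measurable fun (x : V → I) (v : V) => q (x v) := by fun_prop
  let F : (V → S) → ℝ := fun y => ∏ e ∈ G.edgeFinset, A (e.map y)
  calc homDensity G (stepKernel hq A)
      = ∫ x : V → I, F fun v => q (x v) := by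
        simp only [homDensity, pairValue_stepKernel, F]
    _ = ∫ y, F y ∂(Measure.pi fun _ : V => (volume : Measure I).map q) := by
        rw [← hmap, integral_map hmeas.aemeasurable
          (Measurable.of_discrete (f := F)).aestronglyMeasurable]
    _ = ∑ y, c ^ Fintype.card V * F y := by
        rw [integral_fintype Integrable.of_finite]
        refine Finset.sum_congr rfl fun y _ => ?_
        rw [Measure.real, Measure.pi_singleton, ENNReal.toReal_prod, smul_eq_mul]
        congr 1
        simp only [← Measure.real_def, map_measureReal_apply hq (measurableSet_singleton _), hc]
        simp
    _ = c ^ Fintype.card V * homSum G.edgeFinset A := by rw [← Finset.mul_sum]; rfl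

lemma homSumTriangle_of_weaklyNorming {V : Type*} [Fintype V] [DecidableEq V]
    {G : SimpleGraph V} [Fintype G.edgeSet] (hG : WeaklyNorming G) (S : Type*) [Fintype S]
    [Nonempty S] : HomSumTriangle G.edgeFinset S := by
  intro A B hA hB
  let : MeasurableSpace S := ⊤
  have : NeZero (Fintype.card S) := ⟨Fintype.card_ne_zero⟩
  obtain ⟨p, hp, hpc⟩ := exists_measurable_equipartition (Fintype.card S)
  let φ := (Fintype.equivFin S).symm
  have hq : Measurable (φ ∘ p) := (Measurable.of_discrete (f := φ)).comp hp
  have hc : ∀ i, (volume : Measure I).real (φ ∘ p ⁻¹' {i}) = (Fintype.card S : ℝ)⁻¹ := fun i => by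
    rw [← hpc (φ.symm i)]
    congr 1
    ext x
    simp [Equiv.eq_symm_apply]
  have hnorm : ∀ {C : Sym2 S → ℝ}, (∀ z, 0 ≤ C z) → weakNorm G (stepKernel hq C) =
      (((Fintype.card S : ℝ)⁻¹) ^ Fintype.card V) ^ (1 / (G.edgeFinset.card : ℝ)) *
        homSum G.edgeFinset C ^ (1 / (G.edgeFinset.card : ℝ)) := fun hC => by
    rw [weakNorm, absKernel_stepKernel hq hC, homDensity_stepKernel G hq hc,
      Real.mul_rpow (by positivity) (homSum_nonneg _ hC)]
  have hadd : stepKernel hq A + stepKernel hq B = stepKernel hq fun z => A z + B z := rfl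
  have h := hG.add_le (stepKernel hq A) (stepKernel hq B)
  rw [hadd, hnorm hA, hnorm hB, hnorm fun z => add_nonneg (hA z) (hB z), ← mul_add] at h
  have hS : (0 : ℝ) < Fintype.card S := by exact_mod_cast Fintype.card_pos
  exact le_of_mul_le_mul_left h (by positivity)

end StepKernel

end GraphNorm

/-- Every weakly norming graph is edge-transitive. -/
theorem theorem1 {V : Type*} [Fintype V] (G : SimpleGraph V) [Fintype G.edgeSet]
    (hG : GraphNorm.WeaklyNorming G) : GraphNorm.EdgeTransitive G := by
  classical
  intro e he
  have : Nonempty V := ⟨(Quot.out e).1⟩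
  exact GraphNorm.edgeTransitive_of_homSumTriangle
    (fun k => GraphNorm.homSumTriangle_of_weaklyNorming hG (Fin k → V)) e he
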